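/- **Theorem (Density of energy levels).** Let $A=(A_{ij})_{i,j\ge1}$ and $B=(B_{ij})_{i,j\ge1}$ be infinite arrays of real numbers with $A_{ij}=A_{ji}$ and $B_{ij}=-B_{ji}$. For every $n$ let $c_1,\dots,c_n$ be Fermi operators on a complex Hilbert space of dimension $2^n$, i.e. linear operators satisfying the canonical anticommutation relations $c_ic_j+c_jc_i=0$ and $c_ic_j^\dagger+c_j^\dagger c_i=\delta_{ij}$ ($\dagger$ denotes the adjoint), and let $$\mathcal H_n=\sum_{i,j=1}^n\Big(A_{ij}\,c_i^\dagger c_j+\tfrac12B_{ij}\,(c_ic_j-c_i^\dagger c_j^\dagger)\Big),$$ a self-adjoint operator with eigenvalues $E_{1,n}\le\dots\le E_{2^n,n}$, repeated according to multiplicity. Let $X_n=(A_{ij}+B_{ij})_{1\le i,j\le n}$ and $K_n=\frac12\sum_{i=1}^nA_{ii}$. Assume that, for some $\sigma^2\in[0,\infty)$, i) $\lim_{n\to\infty}n^{-1/4}\|X_n\|_{\mathrm{op}}=0$, where $\|\cdot\|_{\mathrm{op}}$ is the operator norm (largest singular value); ii) $\lim_{n\to\infty}\frac1{4n}\mathrm{Tr}(X_n^TX_n)=\sigma^2$.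 Then the empirical measures of the shifted and rescaled energy levels $$\nu_n=\frac1{2^n}\sum_{k=1}^{2^n}\delta_{(E_{k,n}-K_n)/\sqrt n}$$ converge weakly, as $n\to\infty$, to the centred Gaussian probability measure with variance $\sigma^2$ (with density $\frac1{\sqrt{2\pi\sigma^2}}e^{-E^2/(2\sigma^2)}$ if $\sigma^2>0$, and the point mass at $0$ if $\sigma^2=0$). -/

import Mathlib

open MeasureTheory ProbabilityTheory Filter Topology

namespace QuadraticFermi

/-- The compression `Pₙ M Pₙ` of an infinite array `M` to the first `n` coordinates,
seen as an `n × n` matrix. -/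
def truncate (n : ℕ) (M : Matrix ℕ ℕ ℝ) : Matrix (Fin n) (Fin n) ℝ :=
  M.submatrix Fin.val Fin.val

/-- The operator norm of a real square matrix with respect to the Euclidean norm
(its largest singular value). -/
noncomputable def opNorm {n : ℕ} (M : Matrix (Fin n) (Fin n) ℝ) : ℝ :=
  ‖Matrix.toEuclideanCLM (n := Fin n) (𝕜 := ℝ) M‖

section Hamiltonian

variable {V : Type*} [NormedAddCommGroup V] [InnerProductSpace ℂ V] [FiniteDimensional ℂ V]

/-- The canonical anticommutation relations `{cᵢ, cⱼ} = 0` and `{cᵢ, cⱼ†} = δᵢⱼ` for operators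
`c₁, …, cₙ` on a finite-dimensional complex Hilbert space, where `†` is the Hilbert-space
adjoint. -/
structure IsFermi {n : ℕ} (c : Fin n → V →ₗ[ℂ] V) : Prop where
  anticomm : ∀ i j, c i * c j + c j * c i = 0
  anticomm_adjoint : ∀ i j,
    c i * LinearMap.adjoint (c j) + LinearMap.adjoint (c j) * c i = if i = j then 1 else 0

/-- The quadratic form `∑ᵢⱼ Aᵢⱼ cᵢ† cⱼ + ½ Bᵢⱼ (cᵢ cⱼ - cᵢ† cⱼ†)`. -/
noncomputable def quadraticForm (A B : Matrix ℕ ℕ ℝ) {n : ℕ} (c : Fin n → V →ₗ[ℂ] V) :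
    V →ₗ[ℂ] V :=
  ∑ i : Fin n, ∑ j : Fin n,
    ((A i j : ℂ) • (LinearMap.adjoint (c i) * c j) +
      ((1 / 2 : ℂ) * (B i j : ℂ)) •
        (c i * c j - LinearMap.adjoint (c i) * LinearMap.adjoint (c j)))

theorem quadraticForm_isSymmetric {A B : Matrix ℕ ℕ ℝ} (hA : A.transpose = A)
    (hB : B.transpose = -B) {n : ℕ} (c : Fin n → V →ₗ[ℂ] V) :
    (quadraticForm A B c).IsSymmetric := by
  have hA' : ∀ i j, A j i = A i j := fun i j => congrFun (congrFun hA i) j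
  have hB' : ∀ i j, B j i = -B i j := fun i j => congrFun (congrFun hB i) j
  rw [LinearMap.isSymmetric_iff_isSelfAdjoint, isSelfAdjoint_iff]
  unfold quadraticForm
  simp only [star_sum, star_add, star_smul, star_sub, star_mul (R := V →ₗ[ℂ] V), LinearMap.star_eq_adjoint,
    LinearMap.adjoint_adjoint]
  rw [Finset.sum_comm]
  refine Finset.sum_congr rfl fun i _ => Finset.sum_congr rfl fun j _ => ?_
  rw [hA' i j, hB' i j]
  congr 1
  · simp
  · have h : star ((1 / 2 : ℂ) * ((-B i j : ℝ) : ℂ)) = -((1 / 2 : ℂ) * (B i j : ℂ)) := by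
      simp
    rw [h, neg_smul, ← smul_neg, neg_sub]

/-- The energy levels: the `2ⁿ` real eigenvalues of the quadratic form on a Hilbert space of
dimension `2ⁿ`, each listed as often as its multiplicity. -/
noncomputable def energyLevel {A B : Matrix ℕ ℕ ℝ} (hA : A.transpose = A)
    (hB : B.transpose = -B) {n : ℕ} (hV : Module.finrank ℂ V = 2 ^ n)
    (c : Fin n → V →ₗ[ℂ] V) : Fin (2 ^ n) → ℝ :=
  (quadraticForm_isSymmetric hA hB c).eigenvalues hV

end Hamiltonian

/-- The shift `Kₙ = Tr(Pₙ A Pₙ) / 2`. -/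
noncomputable def energyShift (A : Matrix ℕ ℕ ℝ) (n : ℕ) : ℝ :=
  (truncate n A).trace / 2

/-- The normalised counting measure `N⁻¹ ∑ₖ δ(xₖ)` of a finite nonempty list of reals. -/
noncomputable def empiricalMeasure {N : ℕ} [NeZero N] (x : Fin N → ℝ) : ProbabilityMeasure ℝ :=
  ⟨(N : ENNReal)⁻¹ • ∑ k, Measure.dirac (x k), ⟨by
    simp [ENNReal.inv_mul_cancel (Nat.cast_ne_zero.mpr (NeZero.ne N)) (ENNReal.natCast_ne_top N)]⟩⟩

/-- The centred Gaussian law on `ℝ` with variance `σ²` (the point mass at `0` if `σ = 0`). -/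
noncomputable def centredGaussian (σ : ℝ) : ProbabilityMeasure ℝ :=
  ⟨gaussianReal 0 (Real.toNNReal (σ ^ 2)), inferInstance⟩

end QuadraticFermi

/-!
The shifted Hamiltonian is a sum of independent symmetric two-level systems, so the theorem is a
central limit theorem for weighted random signs.

With the Majorana operators `aᵢ = cᵢ + cᵢ†` and `bᵢ = cᵢ† - cᵢ` the canonical anticommutation
relations become Clifford relations, and `H - K = ½ ∑ᵢⱼ Xᵢⱼ bⱼ aᵢ`
(`IsFermi.quadraticForm_sub_energyShift`). A singular value decomposition `X = ∑ₖ sₖ uₖ vₖᵀ`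
rotates both families orthogonally, which preserves the Clifford relations (`rotate_anticomm`), and
gives `H - K = ½ ∑ₖ sₖ Γₖ` with commuting involutions `Γₖ`. The products of distinct `Γₖ` are
traceless, because the rotated operator `aₖ` anticommutes with `Γₖ` and commutes with all other
`Γₗ`. Hence `2⁻ⁿ Tr exp (i t (H - K)) = ∏ₖ cos (t sₖ / 2)`
(`trace_exp_sum_involutions`, `exists_sum_exp_energyLevel_eq`), which is the characteristic function
of the shifted, unscaled spectral measure; the eigenvalues themselves need not be computed.

After rescaling by `√n` the arguments are `θₖ = t sₖ / (2 √n)`. Their squares sum to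
`t² Tr (Xᵀ X) / (4 n)`, which tends to `t² σ²`, and they are uniformly small since
`|sₖ| ≤ ‖X‖ = o(n ^ (1/4))`. So the product of cosines tends to `exp (-t² σ² / 2)`
(`tendsto_prod_cos`), and Lévy's continuity theorem concludes, in the case `σ = 0` as well.
-/

namespace QuadraticFermi

/-! ### The trace of the exponential of a sum of commuting involutions -/

section Exponential
variable {𝔸 : Type*} [NormedRing 𝔸] [NormedAlgebra ℂ 𝔸] [CompleteSpace 𝔸]

theorem exp_mul_of_mul_eq_smul {x y : 𝔸} {z : ℂ} (h : x * y = z • y) :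
    NormedSpace.exp x * y = Complex.exp z • y := by
  have hpow : ∀ m : ℕ, x ^ m * y = z ^ m • y := by
    intro m
    induction m with
    | zero => simp
    | succ m ih => rw [pow_succ, mul_assoc, h, mul_smul_comm, ih, smul_smul, pow_succ']
  have h1 := (NormedSpace.exp_series_hasSum_exp' (𝕂 := ℂ) x).mul_right y
  have h2 := (NormedSpace.exp_series_hasSum_exp' (𝕂 := ℂ) z).smul_const y
  rw [← Complex.exp_eq_exp_ℂ] at h2
  refine h1.unique (h2.congr_fun ?_)
  intro m
  simp [hpow, smul_smul]

/-- Euler's formula for an involution, read off from the action of `exp (z • Γ)` on the two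
eigenprojections `(1 ± Γ) / 2`. -/
theorem exp_smul_of_mul_self_eq_one {Γ : 𝔸} (h : Γ * Γ = 1) (z : ℂ) :
    NormedSpace.exp (z • Γ) = Complex.cosh z • (1 : 𝔸) + Complex.sinh z • Γ := by
  have h1 := exp_mul_of_mul_eq_smul (x := z • Γ) (y := 1 + Γ) (z := z)
    (by simp [mul_add, h, add_comm])
  have h2 := exp_mul_of_mul_eq_smul (x := z • Γ) (y := 1 - Γ) (z := -z)
    (by rw [smul_mul_assoc, mul_sub, h, mul_one]; module)
  have h3 : (2 : ℂ) • NormedSpace.exp (z • Γ)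
      = NormedSpace.exp (z • Γ) * (1 + Γ) + NormedSpace.exp (z • Γ) * (1 - Γ) := by
    rw [← mul_add, two_smul, add_add_sub_cancel, ← two_smul ℂ (1 : 𝔸), mul_smul_comm, mul_one,
      two_smul]
  rw [h1, h2] at h3
  have h4 := congrArg (fun w => (2 : ℂ)⁻¹ • w) h3
  simp only [smul_smul] at h4
  norm_num at h4
  rw [h4, Complex.cosh, Complex.sinh]
  module

/-- If each of the commuting involutions `Γ k` is reversed by some involution `g k` that commutes
with all the others, then, for a tracial functional `τ`, all products of distinct `Γ k` other than
the empty one have trace `0`, so the trace of `exp (∑ z k • Γ k) = ∏ (cosh (z k) + sinh (z k) Γ k)`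
only sees the `cosh` terms. -/
theorem trace_exp_sum_involutions {ι : Type*} (τ : 𝔸 →ₗ[ℂ] ℂ) (hτ : ∀ x y, τ (x * y) = τ (y * x))
    {Γ g : ι → 𝔸} (hΓ : ∀ k, Γ k * Γ k = 1) (hg : ∀ k, g k * g k = 1)
    (hcomm : ∀ k l, Commute (Γ k) (Γ l)) (hanti : ∀ k, g k * Γ k = -(Γ k * g k))
    (hgΓ : ∀ k l, k ≠ l → Commute (g k) (Γ l)) (z : ι → ℂ) (s : Finset ι) :
    τ (NormedSpace.exp (∑ k ∈ s, z k • Γ k)) = (∏ k ∈ s, Complex.cosh (z k)) * τ 1 := by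
  classical
  let : NormedAlgebra ℚ 𝔸 := NormedAlgebra.restrictScalars ℚ ℂ 𝔸
  induction s using Finset.induction_on with
  | empty => simp
  | insert a s ha ih =>
    set W := NormedSpace.exp (∑ k ∈ s, z k • Γ k) with hW
    have hgW : Commute (g a) W :=
      (Commute.sum_right _ _ _ fun l hl =>
        (hgΓ a l (by rintro rfl; exact ha hl)).smul_right _).exp_right
    have hvanish : τ (Γ a * W) = 0 := by
      -- Conjugation by `g a` preserves the trace, fixes `W` and reverses `Γ a`.
      have h : τ (Γ a * W) = -τ (Γ a * W) := by
        calc τ (Γ a * W) = τ (g a * (g a * (Γ a * W))) := by rw [← mul_assoc, hg, one_mul]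
          _ = τ (g a * (Γ a * W) * g a) := hτ _ _
          _ = τ (-(Γ a * W)) := by
            congr 1
            rw [← mul_assoc, hanti, neg_mul, neg_mul, mul_assoc, mul_assoc, ← hgW.eq,
              ← mul_assoc (g a), hg, one_mul]
          _ = -τ (Γ a * W) := map_neg _ _
      exact self_eq_neg.mp h
    rw [Finset.sum_insert ha, NormedSpace.exp_add_of_commute, exp_smul_of_mul_self_eq_one (hΓ a),
      Finset.prod_insert ha, add_mul, smul_mul_assoc, smul_mul_assoc, one_mul, map_add, map_smul,
      map_smul, hvanish, ih, smul_zero, add_zero, smul_eq_mul, mul_assoc]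
    exact Commute.sum_right _ _ _ fun l _ => ((hcomm a l).smul_right _).smul_left _

end Exponential

/-! ### Sums of anticommuting families -/

section Clifford
variable {R : Type*} [Ring R] [Algebra ℂ R] {ι : Type*} [Fintype ι]

theorem anticomm_sum_smul (x y : ι → ℂ) (a b : ι → R) :
    (∑ i, x i • a i) * (∑ j, y j • b j) + (∑ j, y j • b j) * (∑ i, x i • a i) =
      ∑ i, ∑ j, (x i * y j) • (a i * b j + b j * a i) := by
  rw [Finset.sum_mul_sum, Finset.sum_mul_sum, Finset.sum_comm (s := Finset.univ (α := ι))
    (f := fun i j => y i • b i * x j • a j), ← Finset.sum_add_distrib]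
  refine Finset.sum_congr rfl fun i _ => ?_
  rw [← Finset.sum_add_distrib]
  refine Finset.sum_congr rfl fun j _ => ?_
  rw [smul_mul_smul_comm, smul_mul_smul_comm, mul_comm (y j), smul_add]

/-- Real linear combinations of families with Clifford anticommutators `z δᵢⱼ` anticommute to `z`
times the inner product of the coefficient vectors; hence an orthogonal change of basis preserves
the Clifford relations. -/
theorem rotate_anticomm {n : ℕ} {a b : Fin n → R} {z : ℂ}
    (h : ∀ i j, a i * b j + b j * a i = if i = j then z • 1 else 0)
    (x y : EuclideanSpace ℝ (Fin n)) :
    (∑ i, (x i : ℂ) • a i) * (∑ j, (y j : ℂ) • b j) +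
      (∑ j, (y j : ℂ) • b j) * (∑ i, (x i : ℂ) • a i) = ((inner ℝ x y : ℝ) : ℂ) • z • 1 := by
  rw [anticomm_sum_smul]
  simp only [h, smul_ite, smul_zero, Finset.sum_ite_eq, Finset.mem_univ, if_true]
  rw [← Finset.sum_smul]
  congr 1
  simp [PiLp.inner_apply, mul_comm]

theorem sum_eq_sum_of_symmetrization_eq {ι M : Type*} [Fintype ι] [AddCommGroup M] [Module ℂ M]
    {f g : ι → ι → M} (h : ∀ i j, f i j + f j i = g i j + g j i) :
    ∑ i, ∑ j, f i j = ∑ i, ∑ j, g i j := by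
  have hsymm : ∀ f : ι → ι → M, (2 : ℂ) • ∑ i, ∑ j, f i j = ∑ i, ∑ j, (f i j + f j i) := by
    intro f
    simp only [Finset.sum_add_distrib]
    rw [two_smul, Finset.sum_comm (f := fun i j => f j i)]
  refine (smul_right_injective M (two_ne_zero (α := ℂ))) ?_
  simp only [hsymm, h]

end Clifford

/-! ### The singular value decomposition -/

section SVD
variable {E : Type*} [NormedAddCommGroup E] [InnerProductSpace ℝ E] [FiniteDimensional ℝ E]

/-- Singular value decomposition of an endomorphism: `v` is an eigenbasis of `T† T`, and `u`
completes the normalised nonzero vectors among the `T (v k)`, which are orthogonal. -/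
theorem exists_singular_value_decomposition {n : ℕ} (hn : Module.finrank ℝ E = n) (T : E →ₗ[ℝ] E) :
    ∃ (u v : OrthonormalBasis (Fin n) ℝ E) (s : Fin n → ℝ), ∀ k, T (v k) = s k • u k := by
  have hS : (LinearMap.adjoint T * T).IsSymmetric := T.isSymmetric_adjoint_mul_self
  let v := hS.eigenvectorBasis hn
  have horth : ∀ k l, k ≠ l → inner ℝ (T (v k)) (T (v l)) = 0 := by
    intro k l hkl
    rw [← LinearMap.adjoint_inner_right]
    change inner ℝ (v k) ((LinearMap.adjoint T * T) (v l)) = 0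
    rw [hS.apply_eigenvectorBasis, inner_smul_right, v.orthonormal.2 hkl, mul_zero]
  let w : Fin n → E := fun k => ‖T (v k)‖⁻¹ • T (v k)
  have hw : Orthonormal ℝ (Set.domRestrict {k | T (v k) ≠ 0} w) := by
    constructor
    · rintro ⟨k, hk⟩
      have : ‖T (v k)‖ ≠ 0 := norm_ne_zero_iff.mpr hk
      simp [w, Set.domRestrict_apply, norm_smul, this]
    · rintro ⟨k, hk⟩ ⟨l, hl⟩ hkl
      have : k ≠ l := fun h => hkl (Subtype.ext h)
      simp [w, Set.domRestrict_apply, inner_smul_left, inner_smul_right, horth k l this]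
  obtain ⟨u, hu⟩ := hw.exists_orthonormalBasis_extension_of_card_eq (by simp [hn])
  refine ⟨u, v, fun k => ‖T (v k)‖, fun k => ?_⟩
  by_cases hk : T (v k) = 0
  · simp [hk]
  · rw [hu k hk, smul_smul, mul_inv_cancel₀ (norm_ne_zero_iff.mpr hk), one_smul]

end SVD

/-- The singular value decomposition `X = ∑ₖ sₖ uₖ vₖᵀ`, with the two norms of `X` that control the
singular values. -/
theorem exists_matrix_singular_value_decomposition {n : ℕ} (X : Matrix (Fin n) (Fin n) ℝ) :
    ∃ (u v : OrthonormalBasis (Fin n) ℝ (EuclideanSpace ℝ (Fin n))) (s : Fin n → ℝ),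
      (∀ i j, X i j = ∑ k, s k * u k i * v k j) ∧ (∀ k, |s k| ≤ opNorm X) ∧
        ∑ k, s k ^ 2 = (X.transpose * X).trace := by
  set T := Matrix.toEuclideanCLM (n := Fin n) (𝕜 := ℝ) X with hT
  obtain ⟨u, v, s, hs⟩ := exists_singular_value_decomposition
    (finrank_euclideanSpace_fin (𝕜 := ℝ) (n := n)) (T : EuclideanSpace ℝ (Fin n) →ₗ[ℝ] _)
  have hs' : ∀ k, T (v k) = s k • u k := hs
  refine ⟨u, v, s, fun i j => ?_, fun k => ?_, ?_⟩
  · have h1 : T (EuclideanSpace.single j 1) i = X i j := by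
      simp [hT, EuclideanSpace.single]
    have h2 := v.sum_repr' (EuclideanSpace.single j (1 : ℝ))
    rw [← h1, ← h2, map_sum]
    simp only [map_smul, hs', EuclideanSpace.inner_single_right]
    simp
    exact Finset.sum_congr rfl fun k _ => by ring
  · have h := T.le_opNorm (v k)
    rwa [hs', norm_smul, u.norm_eq_one, v.norm_eq_one, mul_one, mul_one, Real.norm_eq_abs] at h
  · have htr : (X.transpose * X).trace =
        LinearMap.trace ℝ _ (Matrix.toEuclideanCLM (n := Fin n) (𝕜 := ℝ) (X.transpose * X) :
          EuclideanSpace ℝ (Fin n) →ₗ[ℝ] EuclideanSpace ℝ (Fin n)) := by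
      rw [LinearMap.trace_eq_sum_inner _ (EuclideanSpace.basisFun (Fin n) ℝ)]
      refine Finset.sum_congr rfl fun i _ => ?_
      simp [EuclideanSpace.single, EuclideanSpace.inner_single_left]
      rfl
    rw [htr, LinearMap.trace_eq_sum_inner _ v]
    refine Finset.sum_congr rfl fun k _ => ?_
    have hstar : Matrix.toEuclideanCLM (n := Fin n) (𝕜 := ℝ) (X.transpose * X) =
        ContinuousLinearMap.adjoint T * T := by
      rw [map_mul, ← ContinuousLinearMap.star_eq_adjoint, hT, ← map_star,
        Matrix.star_eq_conjTranspose, Matrix.conjTranspose_eq_transpose_of_trivial]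
    rw [hstar]
    change _ = inner ℝ (v k) (ContinuousLinearMap.adjoint T (T (v k)))
    rw [ContinuousLinearMap.adjoint_inner_right, hs', inner_smul_left, inner_smul_right,
      real_inner_self_eq_norm_sq, u.norm_eq_one]
    simp [sq]

/-! ### Triangular products of cosines -/

section Cos

theorem abs_cos_sub_exp_le {x : ℝ} (hx : |x| ≤ 1) :
    |Real.cos x - Real.exp (-(x ^ 2 / 2))| ≤ x ^ 4 := by
  have hx2 : x ^ 2 ≤ 1 := (sq_le_one_iff_abs_le_one x).mpr hx
  have h1 := Real.cos_bound hx
  have h2 := Real.abs_exp_sub_one_sub_id_le (x := -(x ^ 2 / 2))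
    (by rw [abs_neg, abs_of_nonneg (by positivity)]; linarith)
  have h4 : |x| ^ 4 = x ^ 4 := by rw [← abs_pow, abs_of_nonneg (by positivity)]
  rw [h4] at h1
  have hx4 : 0 ≤ x ^ 4 := by positivity
  rw [abs_le] at *
  constructor <;> nlinarith

theorem abs_prod_sub_prod_le_sum {ι : Type*} (s : Finset ι) {f g : ι → ℝ} (hf : ∀ i, |f i| ≤ 1)
    (hg : ∀ i, |g i| ≤ 1) : |∏ i ∈ s, f i - ∏ i ∈ s, g i| ≤ ∑ i ∈ s, |f i - g i| := by
  classical
  induction s using Finset.induction_on with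
  | empty => simp
  | insert a s ha ih =>
    rw [Finset.prod_insert ha, Finset.prod_insert ha, Finset.sum_insert ha]
    have hP : |∏ i ∈ s, g i| ≤ 1 := by
      rw [Finset.abs_prod]
      exact Finset.prod_le_one (fun _ _ => abs_nonneg _) fun i _ => hg i
    calc _ = |(f a - g a) * ∏ i ∈ s, g i + f a * (∏ i ∈ s, f i - ∏ i ∈ s, g i)| := by ring_nf
      _ ≤ |f a - g a| * |∏ i ∈ s, g i| + |f a| * |∏ i ∈ s, f i - ∏ i ∈ s, g i| := by
        rw [← abs_mul, ← abs_mul]; exact abs_add_le _ _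
      _ ≤ |f a - g a| * 1 + 1 * ∑ i ∈ s, |f i - g i| := by
        gcongr; exact hf a
      _ = _ := by ring

/-- The central limit theorem for signs with uniformly small weights, in Fourier form:
`cos x = exp (-x² / 2) + O(x⁴)`, and `∑ θ⁴ ≤ (max θ²) ∑ θ²` tends to `0`. -/
theorem tendsto_prod_cos {θ : ∀ n : ℕ, Fin n → ℝ} {ε : ℕ → ℝ} {V : ℝ}
    (hθ : ∀ n k, |θ n k| ≤ ε n) (hε : Tendsto ε atTop (𝓝 0))
    (hV : Tendsto (fun n => ∑ k, θ n k ^ 2) atTop (𝓝 V)) :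
    Tendsto (fun n => ∏ k, Real.cos (θ n k)) atTop (𝓝 (Real.exp (-(V / 2)))) := by
  have hexp : Tendsto (fun n => ∏ k, Real.exp (-(θ n k ^ 2 / 2))) atTop
      (𝓝 (Real.exp (-(V / 2)))) := by
    simp_rw [← Real.exp_sum, Finset.sum_neg_distrib, ← Finset.sum_div]
    exact (Real.continuous_exp.tendsto _).comp (hV.div_const 2).neg
  have hzero : Tendsto (fun n => ε n ^ 2 * ∑ k, θ n k ^ 2) atTop (𝓝 0) := by
    simpa using (hε.pow 2).mul hV
  have hdiff : Tendsto
      (fun n => ∏ k, Real.cos (θ n k) - ∏ k, Real.exp (-(θ n k ^ 2 / 2))) atTop (𝓝 0) := by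
    refine squeeze_zero_norm' ?_ hzero
    filter_upwards [hε.eventually_le_const one_pos] with n hn
    rw [Real.norm_eq_abs]
    refine (abs_prod_sub_prod_le_sum _ (fun k => Real.abs_cos_le_one _) fun k => ?_).trans ?_
    · rw [abs_of_pos (Real.exp_pos _)]
      exact Real.exp_le_one_iff.mpr (by have := sq_nonneg (θ n k); linarith)
    · rw [Finset.mul_sum]
      refine Finset.sum_le_sum fun k _ => (abs_cos_sub_exp_le ((hθ n k).trans hn)).trans ?_
      have h2 : θ n k ^ 2 ≤ ε n ^ 2 := sq_le_sq' (abs_le.mp (hθ n k)).1 (abs_le.mp (hθ n k)).2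
      nlinarith [sq_nonneg (θ n k)]
  simpa using hdiff.add hexp

end Cos

/-! ### Majorana operators -/

section Majorana
variable {V : Type*} [NormedAddCommGroup V] [InnerProductSpace ℂ V] [FiniteDimensional ℂ V]
  {n : ℕ} {c : Fin n → V →ₗ[ℂ] V}

/-- The Majorana operators `aᵢ = cᵢ + cᵢ†`, with `aᵢ² = 1`. -/
noncomputable def majoranaA (c : Fin n → V →ₗ[ℂ] V) (i : Fin n) : V →ₗ[ℂ] V :=
  c i + LinearMap.adjoint (c i)

/-- The second family of Majorana operators, `bᵢ = cᵢ† - cᵢ`. They are skew-adjoint with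
`bᵢ² = -1`; leaving out the factor `√-1` keeps the coefficients of the Hamiltonian real. -/
noncomputable def majoranaB (c : Fin n → V →ₗ[ℂ] V) (i : Fin n) : V →ₗ[ℂ] V :=
  LinearMap.adjoint (c i) - c i

theorem IsFermi.adjoint_anticomm_adjoint (hc : IsFermi c) (i j : Fin n) :
    LinearMap.adjoint (c i) * LinearMap.adjoint (c j) +
      LinearMap.adjoint (c j) * LinearMap.adjoint (c i) = 0 := by
  have h := congrArg star (hc.anticomm j i)
  simpa only [star_add, star_mul (R := V →ₗ[ℂ] V), LinearMap.star_eq_adjoint, map_zero] using h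

theorem IsFermi.adjoint_anticomm (hc : IsFermi c) (i j : Fin n) :
    LinearMap.adjoint (c i) * c j + c j * LinearMap.adjoint (c i) = if i = j then 1 else 0 := by
  rw [add_comm, hc.anticomm_adjoint j i]
  simp only [eq_comm]

theorem IsFermi.majoranaA_anticomm (hc : IsFermi c) (i j : Fin n) :
    majoranaA c i * majoranaA c j + majoranaA c j * majoranaA c i =
      if i = j then (2 : ℂ) • 1 else 0 := by
  have h : majoranaA c i * majoranaA c j + majoranaA c j * majoranaA c i =
      (c i * c j + c j * c i) + (LinearMap.adjoint (c i) * LinearMap.adjoint (c j) +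
        LinearMap.adjoint (c j) * LinearMap.adjoint (c i)) +
      (c i * LinearMap.adjoint (c j) + LinearMap.adjoint (c j) * c i) +
      (LinearMap.adjoint (c i) * c j + c j * LinearMap.adjoint (c i)) := by
    unfold majoranaA; noncomm_ring
  rw [h, hc.anticomm, hc.adjoint_anticomm_adjoint, hc.anticomm_adjoint, hc.adjoint_anticomm]
  split_ifs <;> module

theorem IsFermi.majoranaB_anticomm (hc : IsFermi c) (i j : Fin n) :
    majoranaB c i * majoranaB c j + majoranaB c j * majoranaB c i =
      if i = j then (-2 : ℂ) • 1 else 0 := by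
  have h : majoranaB c i * majoranaB c j + majoranaB c j * majoranaB c i =
      (c i * c j + c j * c i) + (LinearMap.adjoint (c i) * LinearMap.adjoint (c j) +
        LinearMap.adjoint (c j) * LinearMap.adjoint (c i)) -
      (c i * LinearMap.adjoint (c j) + LinearMap.adjoint (c j) * c i) -
      (LinearMap.adjoint (c i) * c j + c j * LinearMap.adjoint (c i)) := by
    unfold majoranaB; noncomm_ring
  rw [h, hc.anticomm, hc.adjoint_anticomm_adjoint, hc.anticomm_adjoint, hc.adjoint_anticomm]
  split_ifs <;> module

theorem IsFermi.majoranaA_anticomm_majoranaB (hc : IsFermi c) (i j : Fin n) :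
    majoranaA c i * majoranaB c j + majoranaB c j * majoranaA c i = 0 := by
  have h : majoranaA c i * majoranaB c j + majoranaB c j * majoranaA c i =
      (LinearMap.adjoint (c i) * LinearMap.adjoint (c j) +
        LinearMap.adjoint (c j) * LinearMap.adjoint (c i)) - (c i * c j + c j * c i) +
      (c i * LinearMap.adjoint (c j) + LinearMap.adjoint (c j) * c i) -
      (LinearMap.adjoint (c i) * c j + c j * LinearMap.adjoint (c i)) := by
    unfold majoranaA majoranaB; noncomm_ring
  rw [h, hc.anticomm, hc.adjoint_anticomm_adjoint, hc.anticomm_adjoint, hc.adjoint_anticomm]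
  simp

theorem IsFermi.majoranaB_mul_majoranaA (hc : IsFermi c) (i j : Fin n) :
    majoranaB c j * majoranaA c i =
      LinearMap.adjoint (c j) * c i + LinearMap.adjoint (c i) * c j +
        (c i * c j - LinearMap.adjoint (c i) * LinearMap.adjoint (c j)) -
        if i = j then 1 else 0 := by
  rw [← hc.adjoint_anticomm i j]
  have h1 := eq_neg_of_add_eq_zero_left (hc.anticomm j i)
  have h2 := eq_neg_of_add_eq_zero_left (hc.adjoint_anticomm_adjoint j i)
  have h : majoranaB c j * majoranaA c i = LinearMap.adjoint (c j) * c i +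
      LinearMap.adjoint (c j) * LinearMap.adjoint (c i) - c j * c i -
      c j * LinearMap.adjoint (c i) := by
    unfold majoranaA majoranaB; noncomm_ring
  rw [h, h1, h2]
  abel

/-- In Majorana operators the shifted Hamiltonian is `½ ∑ᵢⱼ (A + B)ᵢⱼ bⱼ aᵢ`. -/
theorem IsFermi.quadraticForm_sub_energyShift (hc : IsFermi c) {A B : Matrix ℕ ℕ ℝ}
    (hA : A.transpose = A) (hB : B.transpose = -B) :
    quadraticForm A B c - (energyShift A n : ℂ) • 1 =
      ∑ i : Fin n, ∑ j : Fin n,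
        ((1 / 2 : ℂ) * (truncate n (A + B) i j : ℂ)) • (majoranaB c j * majoranaA c i) := by
  have hA' : ∀ i j, A j i = A i j := fun i j => congrFun (congrFun hA i) j
  have hB' : ∀ i j, B j i = -B i j := fun i j => congrFun (congrFun hB i) j
  have hshift : (energyShift A n : ℂ) • (1 : V →ₗ[ℂ] V) =
      ∑ i : Fin n, ∑ j : Fin n, ((1 / 2 : ℂ) * (A i j : ℂ)) • (if i = j then 1 else 0) := by
    simp [energyShift, truncate, Matrix.trace, ← Finset.sum_smul, ← Finset.mul_sum]
    congr 1
    ring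
  rw [hshift, sub_eq_iff_eq_add, ← Finset.sum_add_distrib]
  simp only [← Finset.sum_add_distrib]
  -- Only after symmetrization in `i` and `j` do the summands agree: `A` is symmetric, while `B` and
  -- `cᵢ cⱼ - cᵢ† cⱼ†` are antisymmetric.
  refine sum_eq_sum_of_symmetrization_eq fun i j => ?_
  rw [hc.majoranaB_mul_majoranaA i j, hc.majoranaB_mul_majoranaA j i]
  have h1 : c j * c i = -(c i * c j) := eq_neg_of_add_eq_zero_left (hc.anticomm j i)
  have h2 := eq_neg_of_add_eq_zero_left (hc.adjoint_anticomm_adjoint j i)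
  simp only [truncate, Matrix.submatrix_apply, Matrix.add_apply, hA' i j, hB' i j, h1, h2,
    eq_comm (a := j)]
  push_cast
  module

end Majorana

/-! ### The spectrum in normal modes -/

section NormalModes
variable {V : Type*} [NormedAddCommGroup V] [InnerProductSpace ℂ V] [FiniteDimensional ℂ V]
  {n : ℕ} {c : Fin n → V →ₗ[ℂ] V}

/-- The exponential acts on a unit eigenvector through the exponential of the eigenvalue. -/
theorem exp_apply_of_apply_eq_smul {x : V →L[ℂ] V} {e : V} (he : ‖e‖ = 1) {z : ℂ}
    (h : x e = z • e) : NormedSpace.exp x e = Complex.exp z • e := by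
  have := FiniteDimensional.complete ℂ V
  -- The eigenvector equation becomes `x * P = z • P` for the projection `P` onto the line of `e`.
  let P : V →L[ℂ] V := (innerSL ℂ e).smulRight e
  have hP : P e = e := by simp [P, inner_self_eq_norm_sq_to_K, he]
  have hxP : x * P = z • P := by
    ext w
    simpa [P, h] using smul_comm (inner ℂ e w) z e
  have h2 := congrArg (fun f : V →L[ℂ] V => f e) (exp_mul_of_mul_eq_smul hxP)
  simpa [hP] using h2

/-- For orthonormal bases `u`, `v`, the rotated Majorana operators `bₖ = ∑ⱼ vₖ(j) bⱼ` and
`aₖ = ∑ᵢ uₖ(i) aᵢ` satisfy the Clifford relations again. So the `Γₖ = bₖ aₖ` are commuting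
involutions, and `aₖ` reverses `Γₖ` while commuting with every other `Γₗ`. -/
theorem IsFermi.trace_exp (hc : IsFermi c)
    (u v : OrthonormalBasis (Fin n) ℝ (EuclideanSpace ℝ (Fin n))) (z : Fin n → ℂ) :
    LinearMap.trace ℂ V (NormedSpace.exp (∑ k, z k • Module.End.toContinuousLinearMap V
      ((∑ j, (v k j : ℂ) • majoranaB c j) * (∑ i, (u k i : ℂ) • majoranaA c i))) : V →L[ℂ] V) =
      (∏ k, Complex.cosh (z k)) * Module.finrank ℂ V := by
  have := FiniteDimensional.complete ℂ V
  let Φ := Module.End.toContinuousLinearMap (𝕜 := ℂ) V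
  let a : Fin n → V →ₗ[ℂ] V := fun k => ∑ i, (u k i : ℂ) • majoranaA c i
  let b : Fin n → V →ₗ[ℂ] V := fun k => ∑ j, (v k j : ℂ) • majoranaB c j
  have haa : ∀ k l, a k * a l + a l * a k = if k = l then (2 : ℂ) • 1 else 0 := fun k l => by
    rw [rotate_anticomm hc.majoranaA_anticomm, orthonormal_iff_ite.mp u.orthonormal]
    split_ifs <;> simp
  have hbb : ∀ k l, b k * b l + b l * b k = if k = l then (-2 : ℂ) • 1 else 0 := fun k l => by
    rw [rotate_anticomm hc.majoranaB_anticomm, orthonormal_iff_ite.mp v.orthonormal]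
    split_ifs <;> simp
  have hab : ∀ k l, a k * b l = -(b l * a k) := fun k l => by
    refine eq_neg_of_add_eq_zero_left ?_
    rw [rotate_anticomm (z := 0) (fun i j => by simpa using hc.majoranaA_anticomm_majoranaB i j)]
    simp
  have haa1 : ∀ k, a k * a k = 1 := fun k => by
    have h := haa k k
    rw [if_pos rfl, ← two_smul ℂ] at h
    exact smul_right_injective _ (two_ne_zero (α := ℂ)) h
  have hbb1 : ∀ k, b k * b k = -1 := fun k => by
    have h := hbb k k
    rw [if_pos rfl, ← two_smul ℂ] at h
    refine smul_right_injective _ (two_ne_zero (α := ℂ)) (h.trans ?_)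
    module
  have haa' : ∀ k l, k ≠ l → a k * a l = -(a l * a k) := fun k l hkl =>
    eq_neg_of_add_eq_zero_left (by rw [haa, if_neg hkl])
  have hbb' : ∀ k l, k ≠ l → b k * b l = -(b l * b k) := fun k l hkl =>
    eq_neg_of_add_eq_zero_left (by rw [hbb, if_neg hkl])
  have hacomm : ∀ k l, k ≠ l → Commute (a k) (b l * a l) := fun k l hkl => by
    rw [commute_iff_eq, ← mul_assoc, hab, neg_mul, mul_assoc, haa' k l hkl, mul_neg, neg_neg,
      mul_assoc]
  have hbcomm : ∀ k l, k ≠ l → Commute (b k) (b l * a l) := fun k l hkl => by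
    rw [commute_iff_eq, ← mul_assoc, hbb' k l hkl, neg_mul, mul_assoc, mul_assoc, hab l k, mul_neg]
  let τ : (V →L[ℂ] V) →ₗ[ℂ] ℂ := LinearMap.trace ℂ V ∘ₗ ContinuousLinearMap.coeLM ℂ
  have key := trace_exp_sum_involutions τ (Γ := fun k => Φ (b k * a k)) (g := fun k => Φ (a k))
    (fun x y => LinearMap.trace_mul_comm ℂ (x : V →ₗ[ℂ] V) (y : V →ₗ[ℂ] V))
    (fun k => by
      rw [← map_mul, mul_assoc, ← mul_assoc (a k), hab, neg_mul, mul_assoc (b k), haa1, mul_one,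
        mul_neg, hbb1, neg_neg, map_one])
    (fun k => by rw [← map_mul, haa1, map_one])
    (fun k l => by
      rcases eq_or_ne k l with rfl | hkl
      · exact Commute.refl _
      · exact ((hbcomm k l hkl).mul_left (hacomm k l hkl)).map Φ)
    (fun k => by rw [← map_mul, ← map_mul, ← map_neg, ← mul_assoc, hab, neg_mul])
    (fun k l hkl => (hacomm k l hkl).map Φ) z Finset.univ
  have h1 : τ 1 = Module.finrank ℂ V := LinearMap.trace_one ℂ V
  rw [h1] at key
  exact key

/-- The Fourier transform of the shifted spectrum is that of the `2ⁿ` numbers `½ ∑ₖ ± sₖ`, where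
`s` are the singular values of `Pₙ (A + B) Pₙ`. Both sides are the trace of the exponential of
`i t (H - K)`, on the left in an eigenbasis of `H`, on the right in the normal modes. -/
theorem exists_sum_exp_energyLevel_eq {A B : Matrix ℕ ℕ ℝ} (hA : A.transpose = A)
    (hB : B.transpose = -B) (hV : Module.finrank ℂ V = 2 ^ n) (hc : IsFermi c) :
    ∃ s : Fin n → ℝ, (∀ k, |s k| ≤ opNorm (truncate n (A + B))) ∧
      ∑ k, s k ^ 2 = ((truncate n (A + B)).transpose * truncate n (A + B)).trace ∧
      ∀ t : ℝ, ∑ k, Complex.exp (t * ((energyLevel hA hB hV c k - energyShift A n : ℝ) : ℂ) *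
        Complex.I) = 2 ^ n * ((∏ k, Real.cos (t * s k / 2) : ℝ) : ℂ) := by
  obtain ⟨u, v, s, hX, hle, htr⟩ := exists_matrix_singular_value_decomposition (truncate n (A + B))
  refine ⟨s, hle, htr, fun t => ?_⟩
  let Φ := Module.End.toContinuousLinearMap (𝕜 := ℂ) V
  let b : Fin n → V →ₗ[ℂ] V := fun k => ∑ j, (v k j : ℂ) • majoranaB c j
  let a : Fin n → V →ₗ[ℂ] V := fun k => ∑ i, (u k i : ℂ) • majoranaA c i
  have hH : quadraticForm A B c - (energyShift A n : ℂ) • 1 =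
      ∑ k, ((s k : ℂ) / 2) • (b k * a k) := by
    rw [hc.quadraticForm_sub_energyShift hA hB]
    calc _ = ∑ i, ∑ k, ∑ j,
          ((s k : ℂ) / 2 * (u k i : ℂ) * (v k j : ℂ)) • (majoranaB c j * majoranaA c i) := by
          refine Finset.sum_congr rfl fun i _ => ?_
          rw [Finset.sum_comm]
          refine Finset.sum_congr rfl fun j _ => ?_
          rw [hX, ← Finset.sum_smul]
          congr 1
          push_cast
          rw [Finset.mul_sum]
          exact Finset.sum_congr rfl fun k _ => by ring
      _ = _ := by
          rw [Finset.sum_comm]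
          refine Finset.sum_congr rfl fun k _ => ?_
          rw [Finset.sum_comm, Finset.sum_mul_sum, Finset.smul_sum]
          refine Finset.sum_congr rfl fun j _ => ?_
          rw [Finset.smul_sum]
          refine Finset.sum_congr rfl fun i _ => ?_
          rw [smul_mul_smul_comm, smul_smul]
          congr 1
          ring
  set W : V →L[ℂ] V := NormedSpace.exp (∑ k, (t * s k / 2 * Complex.I : ℂ) • Φ (b k * a k)) with hW
  have htrace : LinearMap.trace ℂ V (W : V →ₗ[ℂ] V) =
      2 ^ n * ((∏ k, Real.cos (t * s k / 2) : ℝ) : ℂ) := by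
    refine (hc.trace_exp u v _).trans ?_
    rw [hV, mul_comm]
    push_cast
    simp only [Complex.cosh_mul_I]
  rw [← htrace, LinearMap.trace_eq_sum_inner _
    ((quadraticForm_isSymmetric hA hB c).eigenvectorBasis hV)]
  refine Finset.sum_congr rfl fun k _ => ?_
  set e := (quadraticForm_isSymmetric hA hB c).eigenvectorBasis hV with he
  have hWx : ∑ k, (t * s k / 2 * Complex.I : ℂ) • Φ (b k * a k) =
      ((t : ℂ) * Complex.I) • Φ (quadraticForm A B c - (energyShift A n : ℂ) • 1) := by
    rw [hH, map_sum, Finset.smul_sum]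
    refine Finset.sum_congr rfl fun k _ => ?_
    rw [map_smul, smul_smul]
    congr 1
    ring
  have hWe : W (e k) = Complex.exp (t * ((energyLevel hA hB hV c k - energyShift A n : ℝ) : ℂ) *
        Complex.I) • e k := by
    refine exp_apply_of_apply_eq_smul (e.norm_eq_one k) ?_
    rw [hWx]
    change ((t : ℂ) * Complex.I) • (quadraticForm A B c (e k) - (energyShift A n : ℂ) • e k) = _
    rw [he, LinearMap.IsSymmetric.apply_eigenvectorBasis, ← he, ← sub_smul, smul_smul]
    congr 1
    simp only [energyLevel]
    push_cast
    rw [mul_right_comm]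
    rfl
  change _ = inner ℂ (e k) (W (e k))
  rw [hWe, inner_smul_right, inner_self_eq_norm_sq_to_K, e.norm_eq_one]
  simp

end NormalModes

/-! ### Characteristic functions and the limit law -/

theorem charFun_empiricalMeasure {N : ℕ} [NeZero N] (x : Fin N → ℝ) (t : ℝ) :
    charFun (empiricalMeasure x : Measure ℝ) t =
      (N : ℂ)⁻¹ * ∑ k, Complex.exp (t * x k * Complex.I) := by
  rw [charFun_apply_real, empiricalMeasure]
  simp only [ProbabilityMeasure.coe_mk]
  rw [integral_smul_measure, integral_finsetSum_measure]
  · simp [Complex.real_smul]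
  · intro i _
    exact integrable_dirac (by simp)

theorem charFun_centredGaussian (σ t : ℝ) :
    charFun (centredGaussian σ : Measure ℝ) t =
      ((Real.exp (-(t ^ 2 * σ ^ 2 / 2)) : ℝ) : ℂ) := by
  rw [centredGaussian, ProbabilityMeasure.coe_mk, charFun_gaussianReal, Complex.ofReal_exp,
    Real.coe_toNNReal _ (sq_nonneg σ)]
  congr 1
  push_cast
  ring

end QuadraticFermi

theorem theorem1
    (A B : Matrix ℕ ℕ ℝ) (hA : A.transpose = A) (hB : B.transpose = -B)
    (V : ℕ → Type*) [∀ n, NormedAddCommGroup (V n)] [∀ n, InnerProductSpace ℂ (V n)]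
    [∀ n, FiniteDimensional ℂ (V n)] (hV : ∀ n, Module.finrank ℂ (V n) = 2 ^ n)
    (c : ∀ n, Fin n → V n →ₗ[ℂ] V n) (hc : ∀ n, QuadraticFermi.IsFermi (c n))
    (X : ∀ n, Matrix (Fin n) (Fin n) ℝ) (hX : ∀ n, X n = QuadraticFermi.truncate n (A + B))
    (σ : ℝ)
    (h_norm : Tendsto (fun n : ℕ => (n : ℝ) ^ (-(1 / 4) : ℝ) * QuadraticFermi.opNorm (X n))
      atTop (𝓝 0))
    (h_trace : Tendsto (fun n : ℕ => 1 / (4 * (n : ℝ)) * ((X n).transpose * X n).trace)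
      atTop (𝓝 (σ ^ 2))) :
    Tendsto
      (fun n : ℕ => QuadraticFermi.empiricalMeasure fun k : Fin (2 ^ n) =>
        (QuadraticFermi.energyLevel hA hB (hV n) (c n) k - QuadraticFermi.energyShift A n)
          / Real.sqrt n)
      atTop (𝓝 (QuadraticFermi.centredGaussian σ)) := by
  obtain rfl : X = fun n => QuadraticFermi.truncate n (A + B) := funext hX
  choose s hle htr hsum using fun n =>
    QuadraticFermi.exists_sum_exp_energyLevel_eq hA hB (hV n) (hc n)
  refine ProbabilityMeasure.tendsto_iff_tendsto_charFun.mpr fun t => ?_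
  have hchar : ∀ n : ℕ, charFun (QuadraticFermi.empiricalMeasure fun k : Fin (2 ^ n) =>
        (QuadraticFermi.energyLevel hA hB (hV n) (c n) k - QuadraticFermi.energyShift A n)
          / Real.sqrt n : Measure ℝ) t =
      ((∏ k, Real.cos (t / Real.sqrt n * s n k / 2) : ℝ) : ℂ) := by
    intro n
    rw [QuadraticFermi.charFun_empiricalMeasure, inv_mul_eq_iff_eq_mul₀ (by simp)]
    push_cast
    have h := hsum n (t / Real.sqrt n)
    push_cast at h
    rw [← h]
    refine Finset.sum_congr rfl fun k _ => ?_
    congr 1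
    ring
  simp only [hchar, QuadraticFermi.charFun_centredGaussian]
  refine (Complex.continuous_ofReal.tendsto _).comp ?_
  refine QuadraticFermi.tendsto_prod_cos
    (ε := fun n => |t| / 2 * ((n : ℝ) ^ (-(1 / 4) : ℝ) *
      QuadraticFermi.opNorm (QuadraticFermi.truncate n (A + B)))) ?_ ?_ ?_
  · intro n k
    have hn : (1 : ℝ) ≤ n := by exact_mod_cast Nat.one_le_iff_ne_zero.mpr (by
      rintro rfl; exact k.elim0)
    -- The scale `n ^ (-1/2)` is dominated by the scale `n ^ (-1/4)` of the operator norm bound.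
    have hpow : (Real.sqrt n)⁻¹ ≤ (n : ℝ) ^ (-(1 / 4) : ℝ) := by
      rw [Real.sqrt_eq_rpow, ← Real.rpow_neg (by positivity)]
      exact Real.rpow_le_rpow_of_exponent_le hn (by norm_num)
    calc |t / Real.sqrt n * s n k / 2| = |t| / 2 * ((Real.sqrt n)⁻¹ * |s n k|) := by
          rw [abs_div, abs_mul, abs_div, abs_of_nonneg (Real.sqrt_nonneg _), abs_two]
          ring
      _ ≤ _ := by
        gcongr
        exact hle n k
  · simpa using h_norm.const_mul (|t| / 2)
  · have h := h_trace.const_mul (t ^ 2)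
    refine h.congr fun n => ?_
    rw [← htr n, Finset.mul_sum, Finset.mul_sum]
    refine Finset.sum_congr rfl fun k _ => ?_
    rw [div_pow, mul_pow, div_pow, Real.sq_sqrt (Nat.cast_nonneg n)]
    ring
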